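/- Let $d$ be a nonnegative integer, let $M\in\mathbb{R}^{d\times d}$ be symmetric positive semidefinite, let $r\in\mathbb{R}^d$ lie in the column space of $M$, and let $\alpha\in\mathbb{R}^d$ have all coordinates nonzero. Put $\ell(x)=\tfrac12\langle x,Mx\rangle-\langle r,x\rangle$ and $\mathrm{Lasso}(x,\lambda)=\ell(x)+\lambda\|x\|_1$ for $x\in\mathbb{R}^d$, and $\mathrm{PosLasso}_*(\lambda)=\min_{x\ge 0}\mathrm{Lasso}(x,\lambda)$, where $x\ge0$ means that all coordinates are nonnegative. For $\varepsilon\in(0,1)$ let $u^\varepsilon:[0,\infty)\to\mathbb{R}^d$ be the solution of the gradient flow $\frac{\mathrm{d}u}{\mathrm{d}t}=-\nabla_u\big(\ell(u\circ u)\big)$ with $u^\varepsilon(0)=\sqrt{\varepsilon}\,\alpha$, where $\circ$ is the componentwise product. Let $x^\varepsilon=u^\varepsilon\circ u^\varepsilon$ (so that $\frac{\mathrm{d}x^\varepsilon}{\mathrm{d}t}=-4\,x^\varepsilon\circ\nabla\ell(x^\varepsilon)$ and $x^\varepsilon(0)=\varepsilon\,\alpha\circ\alpha$), and for $s>0$ let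 $\overline{x}^\varepsilon(s)=\frac1t\int_0^t x^\varepsilon(\tau)\,\mathrm{d}\tau$ with $t=\frac{1}{4}\big(\log\frac1\varepsilon\big)s$. Then there is a constant $C=C(d,M,r,\alpha)>0$ with the following property. For every $s>0$ let $x(s)$ be a minimizer of $\mathrm{Lasso}(\cdot,\frac1s)$ over $\{x\in\mathbb{R}^d: x\ge0\}$, and assume that $s\mapsto x(s)$ is absolutely continuous on compact subsets of $(0,+\infty)$. Let $$z^\downarrow(s)=\sum_{i=1}^d\int_0^s\Big(\frac{\mathrm{d}}{\mathrm{d}\tau}\big(\tau x_i(\tau)\big)\Big)_-\,\mathrm{d}\tau,\qquad a_-=\max(-a,0).$$ Then for every $s>0$, $$\limsup_{\varepsilon\to0^+}\mathrm{Lasso}\Big(\overline{x}^\varepsilon(s),\frac1s\Big)\le\mathrm{PosLasso}_*\Big(\frac1s\Big)+C\left[\frac{(1+s)^{1/2}}{s}\,z^\downarrow(s)^{1/2}+\frac{1+s}{s^2}\,z^\downarrow(s)\right].$$ -/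

import Mathlib

noncomputable section

namespace DLN

/-- The quadratic loss `ℓ(x) = ½ ⟨x, M x⟩ - ⟨r, x⟩` on `ℝ^d`. -/
def loss {d : ℕ} (M : Matrix (Fin d) (Fin d) ℝ) (r x : EuclideanSpace ℝ (Fin d)) : ℝ :=
  1 / 2 * inner ℝ x (M.toEuclideanLin x) - inner ℝ r x

/-- The lasso objective `Lasso(x, lam) = ℓ(x) + lam ‖x‖₁`. -/
def lasso {d : ℕ} (M : Matrix (Fin d) (Fin d) ℝ) (r x : EuclideanSpace ℝ (Fin d))
    (lam : ℝ) : ℝ :=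
  loss M r x + lam * ∑ i, |x i|

/-- The nonnegative orthant `{x | x ≥ 0}` of `ℝ^d`. -/
def nonnegOrthant (d : ℕ) : Set (EuclideanSpace ℝ (Fin d)) := {x | ∀ i, 0 ≤ x i}

/-- The optimal value `PosLasso_*(lam)` of the positive lasso `min_{x ≥ 0} Lasso(x, lam)`. -/
def posLassoMin {d : ℕ} (M : Matrix (Fin d) (Fin d) ℝ) (r : EuclideanSpace ℝ (Fin d))
    (lam : ℝ) : ℝ :=
  sInf ((fun x => lasso M r x lam) '' nonnegOrthant d)

/-- `x` is a minimizer of the positive lasso `min_{x ≥ 0} Lasso(x, lam)`. -/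
def IsPosLassoMinimizer {d : ℕ} (M : Matrix (Fin d) (Fin d) ℝ)
    (r : EuclideanSpace ℝ (Fin d)) (lam : ℝ) (x : EuclideanSpace ℝ (Fin d)) : Prop :=
  x ∈ nonnegOrthant d ∧ IsMinOn (fun y => lasso M r y lam) (nonnegOrthant d) x

/-- The componentwise square `u² = u ∘ u`. -/
def hadamardSq {d : ℕ} (u : EuclideanSpace ℝ (Fin d)) : EuclideanSpace ℝ (Fin d) :=
  WithLp.toLp 2 fun i => u i * u i

/-- `u : [0, ∞) → ℝ^d` solves the gradient flow `du/dt = -∇_u (ℓ(u²))` with initial condition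
`u(0) = u₀` (one-sided derivative at `t = 0`). -/
structure IsGradientFlow {d : ℕ} (M : Matrix (Fin d) (Fin d) ℝ)
    (r u₀ : EuclideanSpace ℝ (Fin d)) (u : ℝ → EuclideanSpace ℝ (Fin d)) : Prop where
  init : u 0 = u₀
  deriv : ∀ t : ℝ, 0 ≤ t →
    HasDerivWithinAt u (-gradient (fun v => loss M r (hadamardSq v)) (u t)) (Set.Ici 0) t

/-- The time average `(1/t) ∫₀ᵗ x(τ) dτ` of a trajectory. -/
def timeAverage {d : ℕ} (x : ℝ → EuclideanSpace ℝ (Fin d)) (t : ℝ) :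
    EuclideanSpace ℝ (Fin d) :=
  (1 / t) • ∫ τ in (0 : ℝ)..t, x τ

/-- The time `t` that corresponds to the rescaled time `s = 4 t / log (1/ε)`. -/
def unscaledTime (ε s : ℝ) : ℝ := Real.log (1 / ε) / 4 * s

/-- `z↓(s) = ∑ᵢ ∫₀ˢ (d/dτ (τ xᵢ(τ)))₋ dτ`, where `a₋ = max (-a) 0`. -/
def zDown {d : ℕ} (x : ℝ → EuclideanSpace ℝ (Fin d)) (s : ℝ) : ℝ :=
  ∑ i, ∫ τ in (0 : ℝ)..s, max (-deriv (fun σ => σ * x σ i) τ) 0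

end DLN

end

/-! Write `M` as the Gram matrix of vectors `q i` and `r i = ⟪q i, b⟫`, so that the loss is `½‖Gx -
b‖²` up to a constant, with `Gx = ∑ xᵢ qᵢ`. With `L = log (1/ε)` and time rescaled by `L/4`, let `X`
be the flow and `Z` its primitive. Integrating the equation for `log Xᵢ` gives `Xᵢ = exp(-L wᵢ)`,
where `wᵢ = 1 + ⟪qᵢ, GZ - tb⟫ - ηᵢ` and `ηᵢ = O(1/L)` (`eq_exp`). Hence `Xᵢ wᵢ ≤ 1/L`, and a bound
`X ≤ cL` gives `wᵢ ≥ -log(cL)/L`. So `Z` nearly satisfies the optimality conditions of the scaled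
positive lasso, except that complementarity holds for `Z' = X` and not for `Z`. The path `z(t) = t
x(t)` satisfies those conditions exactly.

By the Gram structure, `½‖G(Z - z)‖²` has derivative `∑ (Xᵢ - zᵢ')(slackᵢ(Z) - slackᵢ(z))`. The only
term not small as `L → ∞` is `-zᵢ' wᵢ` where `zᵢ` decreases, so the energy is at most `(1 + Ks)
z↓(s)` in the limit (`half_sq_norm_sub_le`). Differentiating the scaled objective along both paths
leaves `⟪b, G(z - Z)⟫` plus small terms, so the gap is at most `s‖b‖` times the root of twice the
energy (`scaledLasso_sub_le`). Dividing by `s²` yields the first term of the claimed bound; the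
second only adds room. -/

open MeasureTheory Set Filter Topology

/-! ### Absolutely continuous functions -/

namespace AbsolutelyContinuousOnInterval

theorem congr_on {X : Type*} [PseudoMetricSpace X] {f g : ℝ → X} {a b : ℝ}
    (hf : AbsolutelyContinuousOnInterval f a b) (h : EqOn f g (uIcc a b)) :
    AbsolutelyContinuousOnInterval g a b := by
  rw [absolutelyContinuousOnInterval_iff] at hf ⊢
  intro ε hε
  obtain ⟨δ, hδ, H⟩ := hf ε hε
  refine ⟨δ, hδ, fun E hE hl => ?_⟩
  convert H E hE hl using 1
  refine Finset.sum_congr rfl fun i hi => ?_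
  have := hE.1 i hi
  rw [h this.1, h this.2]

theorem clm_comp {E F : Type*} [NormedAddCommGroup E] [NormedSpace ℝ E] [NormedAddCommGroup F]
    [NormedSpace ℝ F] (T : E →L[ℝ] F) {f : ℝ → E} {a b : ℝ}
    (hf : AbsolutelyContinuousOnInterval f a b) :
    AbsolutelyContinuousOnInterval (fun t => T (f t)) a b := by
  refine squeeze_zero (fun t => Finset.sum_nonneg fun i _ => dist_nonneg) (fun t => ?_)
    (by simpa using Tendsto.const_mul ‖T‖ hf)
  rw [Finset.mul_sum]
  refine Finset.sum_le_sum fun i _ => ?_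
  simpa [dist_eq_norm, ← map_sub] using T.le_opNorm _

theorem sum {ι F : Type*} [NormedAddCommGroup F] [NormedSpace ℝ F] (s : Finset ι)
    {f : ι → ℝ → F} {a b : ℝ} (hf : ∀ i ∈ s, AbsolutelyContinuousOnInterval (f i) a b) :
    AbsolutelyContinuousOnInterval (fun t => ∑ i ∈ s, f i t) a b := by
  classical
  induction s using Finset.induction_on with
  | empty =>
    simpa using (contDiffOn_const (c := (0 : F))).absolutelyContinuousOnInterval (a := a) (b := b)
  | insert i s hi ih =>
    simp only [Finset.sum_insert hi]
    exact (hf i (by simp)).fun_add (ih fun j hj => hf j (by simp [hj]))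

theorem norm_sq {n : ℕ} {f : ℝ → EuclideanSpace ℝ (Fin n)} {a b : ℝ}
    (hf : AbsolutelyContinuousOnInterval f a b) :
    AbsolutelyContinuousOnInterval (fun t => ‖f t‖ ^ 2) a b := by
  simp only [EuclideanSpace.real_norm_sq_eq]
  refine sum _ fun i _ => ?_
  have h : AbsolutelyContinuousOnInterval (fun t => f t i) a b :=
    clm_comp (EuclideanSpace.proj i : EuclideanSpace ℝ (Fin n) →L[ℝ] ℝ) hf
  simpa only [pow_two] using h.fun_mul h

theorem smul_const {F : Type*} [NormedAddCommGroup F] [NormedSpace ℝ F] {f : ℝ → ℝ} {a b : ℝ}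
    (hf : AbsolutelyContinuousOnInterval f a b) (v : F) :
    AbsolutelyContinuousOnInterval (fun t => f t • v) a b := by
  simpa using clm_comp ((ContinuousLinearMap.id ℝ ℝ).smulRight v) hf

/-- A function that vanishes on `[a, b]` and is absolutely continuous on `[b, c]` is absolutely
continuous on `[a, c]`. -/
theorem of_eq_zero {f : ℝ → ℝ} {a b c : ℝ} (hab : a ≤ b) (hbc : b ≤ c)
    (h0 : ∀ t ∈ Icc a b, f t = 0) (hf : AbsolutelyContinuousOnInterval f b c) :
    AbsolutelyContinuousOnInterval f a c := by
  have hd : ∀ t ∈ Ioo a b, deriv f t = 0 := fun t ht => by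
    have : f =ᶠ[𝓝 t] fun _ => (0 : ℝ) := by
      filter_upwards [Ioo_mem_nhds ht.1 ht.2] with x hx using h0 x ⟨hx.1.le, hx.2.le⟩
    rw [this.deriv_eq, deriv_const]
  have hae : ∀ t ≤ b, ∀ᵐ x, x ∈ uIoc a t → a ≤ t → deriv f x = 0 := fun t ht => by
    have : ∀ᵐ x : ℝ, x ≠ b := by simp [ae_iff]
    filter_upwards [this] with x hx hxt hat
    rw [uIoc_of_le hat] at hxt
    exact hd x ⟨hxt.1, lt_of_le_of_ne (hxt.2.trans ht) hx⟩
  have i1 : IntervalIntegrable (deriv f) volume a b := by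
    refine (intervalIntegrable_const (c := (0 : ℝ))).congr_ae ?_
    refine (ae_restrict_iff' measurableSet_uIoc).2 ?_
    filter_upwards [hae b le_rfl] with x hx hxt using (hx hxt hab).symm
  have i2 : IntervalIntegrable (deriv f) volume a c := i1.trans hf.intervalIntegrable_deriv
  -- On `[a, c]` the function equals the primitive of its derivative, and primitives are absolutely
  -- continuous.
  refine (i2.absolutelyContinuousOnInterval_intervalIntegral (c := a) (by simp)).congr_on ?_
  have z1 : ∀ t ∈ Icc a b, ∫ x in a..t, deriv f x = 0 := fun t ht =>
    intervalIntegral.integral_zero_ae (by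
      filter_upwards [hae t ht.2] with x hx hxt using hx hxt ht.1)
  intro t ht
  rw [uIcc_of_le (hab.trans hbc)] at ht
  rcases le_total t b with htb | htb
  · simp only [z1 t ⟨ht.1, htb⟩, h0 t ⟨ht.1, htb⟩]
  · have hft : AbsolutelyContinuousOnInterval f b t := hf.mono (by
      rw [uIcc_of_le htb, uIcc_of_le hbc]; exact Icc_subset_Icc le_rfl ht.2)
    simp only
    rw [← intervalIntegral.integral_add_adjacent_intervals i1 hft.intervalIntegrable_deriv,
      z1 b ⟨hab, le_rfl⟩, hft.integral_deriv_eq_sub, h0 b ⟨hab, le_rfl⟩]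
    ring

/-- Integrates differential inequalities along the lasso path, which is differentiable only almost
everywhere. -/
theorem sub_le_integral {f g : ℝ → ℝ} {a b : ℝ} (hab : a ≤ b)
    (hf : AbsolutelyContinuousOnInterval f a b) (hg : IntervalIntegrable g volume a b)
    (h : ∀ᵐ t, t ∈ Ioo a b → deriv f t ≤ g t) : f b - f a ≤ ∫ t in a..b, g t := by
  rw [← hf.integral_deriv_eq_sub]
  refine intervalIntegral.integral_mono_ae_restrict hab hf.intervalIntegrable_deriv hg ?_
  refine (ae_restrict_iff' measurableSet_Icc).2 ?_
  have h1 : ∀ᵐ x : ℝ, x ≠ a := by simp [ae_iff]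
  have h2 : ∀ᵐ x : ℝ, x ≠ b := by simp [ae_iff]
  filter_upwards [h, h1, h2] with x hx ha hb hxm
  exact hx ⟨lt_of_le_of_ne hxm.1 (Ne.symm ha), lt_of_le_of_ne hxm.2 hb⟩

end AbsolutelyContinuousOnInterval

/-! ### Least squares form and optimality conditions of the positive lasso -/

namespace DLN

/-- The linear combination `∑ i, x i • q i`. -/
def synthesis {ι H : Type*} [Fintype ι] [AddCommGroup H] [Module ℝ H] (q : ι → H) (x : ι → ℝ) : H :=
  ∑ i, x i • q i

section Gram

variable {d : ℕ} {H : Type*} [NormedAddCommGroup H] [InnerProductSpace ℝ H]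

theorem inner_synthesis_left (q : Fin d → H) (x : Fin d → ℝ) (v : H) :
    inner ℝ (synthesis q x) v = ∑ i, x i * inner ℝ (q i) v := by
  simp [synthesis, sum_inner, real_inner_smul_left]

theorem synthesis_sub (q : Fin d → H) (x y : Fin d → ℝ) :
    synthesis q (x - y) = synthesis q x - synthesis q y := by
  simp [synthesis, sub_smul, Finset.sum_sub_distrib]

theorem synthesis_smul (q : Fin d → H) (c : ℝ) (x : Fin d → ℝ) :
    synthesis q (fun i => c * x i) = c • synthesis q x := by
  simp [synthesis, mul_smul, Finset.smul_sum]

theorem synthesis_add_single (q : Fin d → H) (x : Fin d → ℝ) (i : Fin d) (h : ℝ) :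
    synthesis q (x + Pi.single i h) = synthesis q x + h • q i := by
  simp [synthesis, add_smul, Finset.sum_add_distrib, Pi.single_apply]

theorem norm_synthesis_le (q : Fin d → H) (x : Fin d → ℝ) :
    ‖synthesis q x‖ ≤ ∑ i, |x i| * ‖q i‖ := by
  refine (norm_sum_le _ _).trans (Finset.sum_le_sum fun i _ => ?_)
  rw [norm_smul, Real.norm_eq_abs]

theorem hasDerivAt_synthesis (q : Fin d → H) {f : ℝ → Fin d → ℝ} {f' : Fin d → ℝ} {t : ℝ}
    (h : ∀ i, HasDerivAt (fun s => f s i) (f' i) t) :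
    HasDerivAt (fun s => synthesis q (f s)) (synthesis q f') t := by
  unfold synthesis
  exact HasDerivAt.fun_sum fun i _ => (h i).smul_const (q i)

theorem continuous_synthesis (q : Fin d → H) : Continuous (synthesis q) := by
  unfold synthesis
  fun_prop

end Gram

/-- `M` is the Gram matrix of a family `q`, and the loss is a least squares loss. -/
theorem exists_leastSquares {d : ℕ} {M : Matrix (Fin d) (Fin d) ℝ} (hM : M.PosSemidef)
    {r : EuclideanSpace ℝ (Fin d)} (hr : r ∈ LinearMap.range M.toEuclideanLin) :
    ∃ (m : ℕ) (q : Fin d → EuclideanSpace ℝ (Fin m)) (b : EuclideanSpace ℝ (Fin m)),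
      ∀ x, loss M r x = 1 / 2 * ‖synthesis q x.ofLp - b‖ ^ 2 - 1 / 2 * ‖b‖ ^ 2 := by
  obtain ⟨m, v, hv⟩ := Matrix.posSemidef_iff_eq_sum_vecMulVec.1 hM
  obtain ⟨y, rfl⟩ := hr
  set q : Fin d → EuclideanSpace ℝ (Fin m) := fun i => WithLp.toLp 2 fun k => v k i with hq
  have key : ∀ w x : EuclideanSpace ℝ (Fin d),
      inner ℝ w (M.toEuclideanLin x) = inner ℝ (synthesis q w.ofLp) (synthesis q x.ofLp) := by
    intro w x
    have e : ∀ i j, M i j = inner ℝ (q i) (q j) := by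
      intro i j
      rw [hv]
      simp [Matrix.sum_apply, Matrix.vecMulVec_apply, hq, PiLp.inner_apply, mul_comm]
    rw [inner_synthesis_left, PiLp.inner_apply]
    refine Finset.sum_congr rfl fun i _ => ?_
    rw [real_inner_comm (synthesis q x.ofLp), inner_synthesis_left]
    simp [Matrix.mulVec, dotProduct, e, mul_comm, real_inner_comm]
  -- The column space hypothesis `r = M y` makes `b = Gy` a valid target: `⟪qᵢ, Gy⟫ = (M y)ᵢ = rᵢ`.
  refine ⟨m, q, synthesis q y.ofLp, fun x => ?_⟩
  rw [loss, key, real_inner_comm x, key, norm_sub_sq_real, real_inner_self_eq_norm_sq]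
  ring

section LeastSquares

variable {d : ℕ} {M : Matrix (Fin d) (Fin d) ℝ} {r : EuclideanSpace ℝ (Fin d)}
  {H : Type*} [NormedAddCommGroup H] [InnerProductSpace ℝ H] {q : Fin d → H} {b : H}

theorem gradient_loss_hadamardSq
    (hl : ∀ x, loss M r x = 1 / 2 * ‖synthesis q x.ofLp - b‖ ^ 2 - 1 / 2 * ‖b‖ ^ 2)
    (u : EuclideanSpace ℝ (Fin d)) (i : Fin d) :
    gradient (fun v => loss M r (hadamardSq v)) u i =
      2 * u i * inner ℝ (q i) (synthesis q (hadamardSq u).ofLp - b) := by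
  have hS : HasFDerivAt (fun v : EuclideanSpace ℝ (Fin d) => synthesis q (hadamardSq v).ofLp)
      (∑ j, ((2 * u j) • (EuclideanSpace.proj j : EuclideanSpace ℝ (Fin d) →L[ℝ] ℝ)).smulRight
        (q j)) u := by
    unfold synthesis hadamardSq
    refine HasFDerivAt.fun_sum fun j _ => ?_
    have hp : HasFDerivAt (fun v : EuclideanSpace ℝ (Fin d) => v j)
        (EuclideanSpace.proj j : EuclideanSpace ℝ (Fin d) →L[ℝ] ℝ) u :=
      (EuclideanSpace.proj j : EuclideanSpace ℝ (Fin d) →L[ℝ] ℝ).hasFDerivAt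
    have h2 : HasFDerivAt (fun v : EuclideanSpace ℝ (Fin d) => v j * v j)
        ((2 * u j) • (EuclideanSpace.proj j : EuclideanSpace ℝ (Fin d) →L[ℝ] ℝ)) u := by
      refine (hp.mul hp).congr_fderiv ?_
      ext w
      simp
      ring
    exact h2.smul_const (q j)
  have hF := (((hS.sub_const b).norm_sq).const_mul (1 / 2 : ℝ)).sub_const (1 / 2 * ‖b‖ ^ 2)
  have hF' : HasFDerivAt (fun v => loss M r (hadamardSq v)) _ u :=
    hF.congr_of_eventuallyEq (Eventually.of_forall fun v => hl _)
  have : gradient (fun v => loss M r (hadamardSq v)) u i =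
      inner ℝ (gradient (fun v => loss M r (hadamardSq v)) u) (EuclideanSpace.single i 1) := by
    rw [EuclideanSpace.inner_single_right]
    simp
  rw [this, inner_gradient_left, hF'.fderiv]
  rw [real_inner_comm]
  simp [inner_sub_left]
  ring

theorem lasso_of_nonneg
    (hl : ∀ x, loss M r x = 1 / 2 * ‖synthesis q x.ofLp - b‖ ^ 2 - 1 / 2 * ‖b‖ ^ 2)
    {x : EuclideanSpace ℝ (Fin d)} (hx : ∀ i, 0 ≤ x i) (lam : ℝ) :
    lasso M r x lam =
      1 / 2 * ‖synthesis q x.ofLp - b‖ ^ 2 - 1 / 2 * ‖b‖ ^ 2 + lam * ∑ i, x i := by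
  simp only [lasso, hl, abs_of_nonneg (hx _)]

namespace IsPosLassoMinimizer

theorem posLassoMin_eq {lam : ℝ} {x : EuclideanSpace ℝ (Fin d)}
    (h : IsPosLassoMinimizer M r lam x) : posLassoMin M r lam = lasso M r x lam := by
  refine IsLeast.csInf_eq ⟨mem_image_of_mem _ h.1, ?_⟩
  rintro _ ⟨y, hy, rfl⟩
  exact h.2 hy

/-- The right-hand side is the exact change of the quadratic objective when coordinate `i` moves by
`t`. Both optimality conditions follow from it. -/
theorem coordinate_ineq {lam : ℝ} {x : EuclideanSpace ℝ (Fin d)}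
    (h : IsPosLassoMinimizer M r lam x)
    (hl : ∀ x, loss M r x = 1 / 2 * ‖synthesis q x.ofLp - b‖ ^ 2 - 1 / 2 * ‖b‖ ^ 2)
    (i : Fin d) {t : ℝ} (ht : 0 ≤ x i + t) :
    0 ≤ t * (inner ℝ (q i) (synthesis q x.ofLp - b) + lam) + t ^ 2 * (‖q i‖ ^ 2 / 2) := by
  set y : EuclideanSpace ℝ (Fin d) := WithLp.toLp 2 (x.ofLp + Pi.single i t) with hy
  have hyn : ∀ j, 0 ≤ y j := by
    intro j
    rcases eq_or_ne j i with rfl | hj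
    · simpa [hy] using ht
    · simpa [hy, hj] using h.1 j
  have hxy := h.2 (show y ∈ nonnegOrthant d from hyn)
  simp only [mem_ofPred_eq] at hxy
  rw [lasso_of_nonneg hl h.1, lasso_of_nonneg hl hyn] at hxy
  have e1 : synthesis q y.ofLp - b = (synthesis q x.ofLp - b) + t • q i := by
    rw [hy, synthesis_add_single]; abel
  have e2 : ∑ j, y j = ∑ j, x j + t := by
    simp [hy, Finset.sum_add_distrib]
  rw [e1, e2, norm_add_sq_real, real_inner_smul_right, norm_smul, mul_pow, Real.norm_eq_abs,
    sq_abs, real_inner_comm] at hxy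
  nlinarith

theorem stationarity_nonneg {lam : ℝ} {x : EuclideanSpace ℝ (Fin d)}
    (h : IsPosLassoMinimizer M r lam x)
    (hl : ∀ x, loss M r x = 1 / 2 * ‖synthesis q x.ofLp - b‖ ^ 2 - 1 / 2 * ‖b‖ ^ 2)
    (i : Fin d) : 0 ≤ inner ℝ (q i) (synthesis q x.ofLp - b) + lam := by
  set g := inner ℝ (q i) (synthesis q x.ofLp - b) + lam with hg
  by_contra! hneg
  -- The extra `1` keeps `c` positive if `q i = 0`, and with `t = -g / c` the change is `t g + t² (c
  -- - 1) = -t² < 0`.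
  set c := ‖q i‖ ^ 2 / 2 + 1
  have hc : 0 < c := by positivity
  have ht : 0 < -g / c := div_pos (by linarith) hc
  have := h.coordinate_ineq hl i (t := -g / c) (add_nonneg (h.1 i) ht.le)
  rw [← hg] at this
  have e : -g / c * c = -g := by field_simp
  have e2 : ‖q i‖ ^ 2 / 2 = c - 1 := by simp [c]
  rw [e2] at this
  nlinarith [mul_pos ht ht]

theorem stationarity_eq_zero {lam : ℝ} {x : EuclideanSpace ℝ (Fin d)}
    (h : IsPosLassoMinimizer M r lam x)
    (hl : ∀ x, loss M r x = 1 / 2 * ‖synthesis q x.ofLp - b‖ ^ 2 - 1 / 2 * ‖b‖ ^ 2)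
    (i : Fin d) (hx : 0 < x i) : inner ℝ (q i) (synthesis q x.ofLp - b) + lam = 0 := by
  set g := inner ℝ (q i) (synthesis q x.ofLp - b) + lam with hg
  refine le_antisymm ?_ (h.stationarity_nonneg hl i)
  by_contra! hpos
  set c := ‖q i‖ ^ 2 / 2 + 1
  have hc : 0 < c := by positivity
  -- The cap `x i` keeps the backward step in the orthant; the change is again at most `-t²`.
  set t := min (x i) (g / c)
  have ht : 0 < t := lt_min hx (div_pos hpos hc)
  have := h.coordinate_ineq hl i (t := -t) (by linarith [min_le_left (x i) (g / c)])
  rw [← hg] at this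
  have e : t * c ≤ g := by
    have : t ≤ g / c := min_le_right _ _
    rwa [le_div_iff₀ hc] at this
  have e2 : ‖q i‖ ^ 2 / 2 = c - 1 := by simp [c]
  rw [e2] at this
  nlinarith [mul_pos ht ht]

/-- Comparison with `0`: the linear gain `⟪Gx, b⟫` is at most `(∑ ‖qᵢ‖‖b‖) ∑ xᵢ`, which a larger
penalty outweighs. This makes `t x(t)` vanish near `t = 0`, where no absolute continuity of `x` is
assumed. -/
theorem eq_zero_of_large {lam : ℝ} {x : EuclideanSpace ℝ (Fin d)}
    (h : IsPosLassoMinimizer M r lam x)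
    (hl : ∀ x, loss M r x = 1 / 2 * ‖synthesis q x.ofLp - b‖ ^ 2 - 1 / 2 * ‖b‖ ^ 2)
    (hlam : ∑ i, ‖q i‖ * ‖b‖ < lam) (i : Fin d) : x i = 0 := by
  have h0 : (0 : EuclideanSpace ℝ (Fin d)) ∈ nonnegOrthant d := fun i => by simp
  have hle := h.2 h0
  simp only [mem_ofPred_eq] at hle
  rw [lasso_of_nonneg hl h.1, lasso_of_nonneg hl h0, norm_sub_sq_real, inner_synthesis_left] at hle
  have e0 : synthesis q (0 : EuclideanSpace ℝ (Fin d)).ofLp = 0 := by simp [synthesis]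
  rw [e0] at hle
  simp only [zero_sub, norm_neg, PiLp.zero_apply, Finset.sum_const_zero, mul_zero] at hle
  have hb : ∑ j, x j * inner ℝ (q j) b ≤ ∑ j, x j * (∑ i, ‖q i‖ * ‖b‖) := by
    refine Finset.sum_le_sum fun j _ => mul_le_mul_of_nonneg_left ?_ (h.1 j)
    exact (real_inner_le_norm _ _).trans
      (Finset.single_le_sum (f := fun i => ‖q i‖ * ‖b‖) (fun i _ => by positivity)
        (Finset.mem_univ j))
  rw [← Finset.sum_mul] at hb
  have hs : 0 ≤ ∑ j, x j := Finset.sum_nonneg fun j _ => h.1 j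
  have hsz : ∑ j, x j = 0 := by
    by_contra hne
    have : 0 < ∑ j, x j := lt_of_le_of_ne hs (Ne.symm hne)
    nlinarith [sq_nonneg ‖synthesis q x.ofLp‖, mul_pos this (sub_pos.2 hlam)]
  exact (Finset.sum_eq_zero_iff_of_nonneg fun j _ => h.1 j).1 hsz i (Finset.mem_univ i)

end IsPosLassoMinimizer

end LeastSquares

end DLN

/-! ### Comparison of the lasso path with an approximately optimal monotone path -/

namespace DLN

section Comparison

variable {d n : ℕ} {q : Fin d → EuclideanSpace ℝ (Fin n)} {b : EuclideanSpace ℝ (Fin n)}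

/-- The dual variable `1 + (M z - t r)ᵢ` of the scaled positive lasso, with `M` the Gram matrix
of `q` and `r = (⟪qᵢ, b⟫)ᵢ`. -/
noncomputable def slack (q : Fin d → EuclideanSpace ℝ (Fin n)) (b : EuclideanSpace ℝ (Fin n)) (t : ℝ)
    (z : Fin d → ℝ) (i : Fin d) : ℝ :=
  1 + inner ℝ (q i) (synthesis q z - t • b)

/-- The scaled objective `t² Lasso(z / t, 1 / t)` on the nonnegative orthant, up to a term that
does not depend on `z`. -/
noncomputable def scaledLasso (q : Fin d → EuclideanSpace ℝ (Fin n)) (b : EuclideanSpace ℝ (Fin n)) (t : ℝ)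
    (z : Fin d → ℝ) : ℝ :=
  1 / 2 * ‖synthesis q z - t • b‖ ^ 2 + ∑ i, z i

/-- An absolutely continuous path on `[0, s]` which satisfies the optimality conditions of the
scaled positive lasso. -/
structure IsLassoPath (q : Fin d → EuclideanSpace ℝ (Fin n)) (b : EuclideanSpace ℝ (Fin n))
    (s : ℝ) (z : ℝ → Fin d → ℝ) : Prop where
  ac : ∀ i, AbsolutelyContinuousOnInterval (fun t => z t i) 0 s
  zero : ∀ i, z 0 i = 0
  nonneg : ∀ t ∈ Ioo 0 s, ∀ i, 0 ≤ z t i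
  slack_nonneg : ∀ t ∈ Ioo 0 s, ∀ i, 0 ≤ slack q b t (z t) i
  compl : ∀ t ∈ Ioo 0 s, ∀ i, z t i ≠ 0 → slack q b t (z t) i = 0

/-- A nondecreasing path `Z` on `[0, s]` with derivative `X`, which satisfies the optimality
conditions of the scaled positive lasso up to errors: an offset `η` of the dual variable, a defect
`κ` in the complementarity of `X` and the dual variable, and a defect `θ` in the sign of the dual
variable. -/
structure IsMonotonePath (q : Fin d → EuclideanSpace ℝ (Fin n)) (b : EuclideanSpace ℝ (Fin n))
    (s : ℝ) (η : Fin d → ℝ) (κ θ B : ℝ) (Z X : ℝ → Fin d → ℝ) : Prop where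
  cont : ∀ i, Continuous fun t => X t i
  hasDeriv : ∀ i t, HasDerivAt (fun t => Z t i) (X t i) t
  zero : ∀ i, Z 0 i = 0
  nonneg : ∀ t i, 0 ≤ X t i
  mul_le : ∀ t ∈ Ioo 0 s, ∀ i, X t i * (slack q b t (Z t) i - η i) ≤ κ
  neg_le : ∀ t ∈ Ioo 0 s, ∀ i, -θ ≤ slack q b t (Z t) i - η i
  le : ∀ t ∈ Ioo 0 s, ∀ i, slack q b t (Z t) i - η i ≤ B

variable {s κ θ B h : ℝ} {η : Fin d → ℝ} {z Z X : ℝ → Fin d → ℝ}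

/-- Complementarity passes to the derivative: a zero of `zᵢ ≥ 0` in the open interval is a minimum,
so `zᵢ' = 0` there. -/
theorem IsLassoPath.ae_deriv (hz : IsLassoPath q b s z) (hs : 0 < s) :
    ∀ᵐ t, t ∈ Ioo 0 s → ∀ i, HasDerivAt (fun t => z t i) (deriv (fun t => z t i) t) t ∧
      deriv (fun t => z t i) t * slack q b t (z t) i = 0 := by
  have h1 : ∀ᵐ t, ∀ i, t ∈ uIcc 0 s → DifferentiableAt ℝ (fun t => z t i) t :=
    ae_all_iff.2 fun i => (hz.ac i).ae_differentiableAt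
  filter_upwards [h1] with t ht hts i
  have hts' : t ∈ uIcc 0 s := by rw [uIcc_of_le hs.le]; exact Ioo_subset_Icc_self hts
  refine ⟨(ht i hts').hasDerivAt, ?_⟩
  by_cases h0 : z t i = 0
  · have : IsLocalMin (fun t => z t i) t := by
      filter_upwards [Ioo_mem_nhds hts.1 hts.2] with x hx
      rw [h0]
      exact hz.nonneg x hx i
    rw [this.deriv_eq_zero, zero_mul]
  · rw [hz.compl t hts i h0, mul_zero]

theorem IsMonotonePath.ac (hZ : IsMonotonePath q b s η κ θ B Z X) (i : Fin d) (a c : ℝ) :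
    AbsolutelyContinuousOnInterval (fun t => Z t i) a c := by
  have hd : deriv (fun t => Z t i) = fun t => X t i := funext fun t => (hZ.hasDeriv i t).deriv
  have : ContDiff ℝ 1 fun t => Z t i :=
    contDiff_one_iff_deriv.2 ⟨fun t => (hZ.hasDeriv i t).differentiableAt, hd ▸ hZ.cont i⟩
  exact this.contDiffOn.absolutelyContinuousOnInterval

theorem IsMonotonePath.integral_eq (hZ : IsMonotonePath q b s η κ θ B Z X) (i : Fin d) (t : ℝ) :
    ∫ τ in (0 : ℝ)..t, X τ i = Z t i := by
  rw [intervalIntegral.integral_eq_sub_of_hasDerivAt (fun x _ => hZ.hasDeriv i x)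
    ((hZ.cont i).intervalIntegrable _ _), hZ.zero, sub_zero]

theorem ac_synthesis {f : ℝ → Fin d → ℝ} {a c : ℝ}
    (hf : ∀ i, AbsolutelyContinuousOnInterval (fun t => f t i) a c) :
    AbsolutelyContinuousOnInterval (fun t => synthesis q (f t)) a c :=
  AbsolutelyContinuousOnInterval.sum _ fun i _ => (hf i).smul_const (q i)

/-- The bound on `½ ‖G (Z - z)‖²` in the comparison of the two paths. -/
noncomputable def energyBound (s κ θ B h : ℝ) (z Z : ℝ → Fin d → ℝ) : ℝ :=
  s * (d * κ) + B * ∑ i, (∫ t in (0 : ℝ)..s, max (-deriv (fun t => z t i) t) 0)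
    + (θ + h) * ∑ i, (∫ t in (0 : ℝ)..s, |deriv (fun t => z t i) t|) + h * ∑ i, Z s i

/-- With `w = slack(Z) - η`, each term of the energy derivative splits as `X w + X η - X slack(z) -
z' w - z' η + z' slack(z)`. The third part is nonpositive and the last vanishes. -/
theorem half_sq_norm_sub_le (hs : 0 < s) (hz : IsLassoPath q b s z)
    (hZ : IsMonotonePath q b s η κ θ B Z X) (hκ : 0 ≤ κ) (hθ : 0 ≤ θ) (hB : 0 ≤ B)
    (hh : 0 ≤ h) (hη : ∀ i, |η i| ≤ h) {t : ℝ} (ht : t ∈ Icc 0 s) :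
    1 / 2 * ‖synthesis q (Z t - z t)‖ ^ 2 ≤ energyBound s κ θ B h z Z := by
  set z' : ℝ → Fin d → ℝ := fun t i => deriv (fun t => z t i) t with hz'
  have I' : ∀ i, IntervalIntegrable (fun t => z' t i) volume 0 s := fun i =>
    (hz.ac i).intervalIntegrable_deriv
  have I1 : ∀ i, IntervalIntegrable (fun t => max (-z' t i) 0) volume 0 s := fun i =>
    ⟨(I' i).neg.1.pos_part, (I' i).neg.2.pos_part⟩
  have I2 : ∀ i, IntervalIntegrable (fun t => |z' t i|) volume 0 s := fun i => (I' i).abs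
  have I3 : ∀ i, IntervalIntegrable (fun t => X t i) volume 0 s := fun i =>
    (hZ.cont i).intervalIntegrable _ _
  have J1 : IntervalIntegrable (fun t => ∑ i, max (-z' t i) 0) volume 0 s := by
    simpa only [Finset.sum_fn] using IntervalIntegrable.sum Finset.univ fun i _ => I1 i
  have J2 : IntervalIntegrable (fun t => ∑ i, |z' t i|) volume 0 s := by
    simpa only [Finset.sum_fn] using IntervalIntegrable.sum Finset.univ fun i _ => I2 i
  have J3 : IntervalIntegrable (fun t => ∑ i, X t i) volume 0 s := by
    simpa only [Finset.sum_fn] using IntervalIntegrable.sum Finset.univ fun i _ => I3 i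
  set g : ℝ → ℝ := fun t => d * κ + B * (∑ i, max (-z' t i) 0) + (θ + h) * (∑ i, |z' t i|)
    + h * ∑ i, X t i with hg
  have K0 : IntervalIntegrable (fun _ : ℝ => (d * κ : ℝ)) volume 0 s := intervalIntegrable_const
  have K1 := J1.const_mul B
  have K2 := J2.const_mul (θ + h)
  have K3 := J3.const_mul h
  have Jg : IntervalIntegrable g volume 0 s := ((K0.add K1).add K2).add K3
  have hgi : ∫ t in (0 : ℝ)..s, g t = energyBound s κ θ B h z Z := by
    rw [hg, intervalIntegral.integral_add ((K0.add K1).add K2) K3,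
      intervalIntegral.integral_add (K0.add K1) K2, intervalIntegral.integral_add K0 K1]
    simp only [intervalIntegral.integral_const_mul, intervalIntegral.integral_const]
    rw [intervalIntegral.integral_finsetSum fun i _ => I1 i,
      intervalIntegral.integral_finsetSum fun i _ => I2 i,
      intervalIntegral.integral_finsetSum fun i _ => I3 i]
    simp only [hZ.integral_eq, sub_zero, smul_eq_mul, energyBound, hz']
    ring
  have hg0 : ∀ t, 0 ≤ g t := fun t => by
    have h1 : 0 ≤ ∑ i, max (-z' t i) 0 := Finset.sum_nonneg fun i _ => le_max_right _ _
    have h3 : 0 ≤ ∑ i, X t i := Finset.sum_nonneg fun i _ => hZ.nonneg t i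
    positivity
  have hsub : uIcc 0 t ⊆ uIcc 0 s := by
    rw [uIcc_of_le ht.1, uIcc_of_le hs.le]; exact Icc_subset_Icc le_rfl ht.2
  have hac : AbsolutelyContinuousOnInterval
      (fun t => 1 / 2 * ‖synthesis q (Z t - z t)‖ ^ 2) 0 t :=
    (AbsolutelyContinuousOnInterval.norm_sq (ac_synthesis fun i =>
      (hZ.ac i 0 s).fun_sub (hz.ac i))).const_mul (1 / 2) |>.mono hsub
  have key := hac.sub_le_integral ht.1 (Jg.mono_set hsub) (by
    filter_upwards [hz.ae_deriv hs] with τ hτ hτt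
    have hτs : τ ∈ Ioo 0 s := ⟨hτt.1, hτt.2.trans_le ht.2⟩
    have hD := hasDerivAt_synthesis q (f := fun t => Z t - z t) (f' := fun i => X τ i - z' τ i)
      (t := τ) fun i => (hZ.hasDeriv i τ).sub (hτ hτs i).1
    rw [(hD.norm_sq.const_mul (1 / 2)).deriv, real_inner_comm, inner_synthesis_left]
    have e : ∀ i, inner ℝ (q i) (synthesis q (Z τ - z τ)) =
        slack q b τ (Z τ) i - slack q b τ (z τ) i := fun i => by
      simp only [slack, synthesis_sub, inner_sub_right]; ring
    have hterm : ∀ i, (X τ i - z' τ i) * inner ℝ (q i) (synthesis q (Z τ - z τ)) ≤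
        κ + B * max (-z' τ i) 0 + (θ + h) * |z' τ i| + h * X τ i := fun i => by
      rw [e]
      have c1 := hZ.mul_le τ hτs i
      have c2 := hZ.neg_le τ hτs i
      have c3 := hZ.le τ hτs i
      have c4 : z' τ i * slack q b τ (z τ) i = 0 := (hτ hτs i).2
      have c5 := mul_nonneg (hZ.nonneg τ i) (hz.slack_nonneg τ hτs i)
      have c6 : X τ i * η i ≤ X τ i * h :=
        mul_le_mul_of_nonneg_left ((le_abs_self _).trans (hη i)) (hZ.nonneg τ i)
      have c7 : -(z' τ i * η i) ≤ |z' τ i| * h :=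
        (neg_le_abs _).trans ((abs_mul _ _).le.trans
          (mul_le_mul_of_nonneg_left (hη i) (abs_nonneg _)))
      -- The bound `w ≤ B` is needed only where `z` decreases; elsewhere `w ≥ -θ` suffices. This is
      -- how `z↓` enters.
      have c8 : -(z' τ i * (slack q b τ (Z τ) i - η i)) ≤
          B * max (-z' τ i) 0 + θ * |z' τ i| := by
        rcases le_total (z' τ i) 0 with hn | hp
        · rw [max_eq_left (by linarith)]
          nlinarith [mul_nonneg hθ (abs_nonneg (z' τ i))]
        · rw [max_eq_right (by linarith), abs_of_nonneg hp]
          nlinarith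
      linarith
    have hsum := Finset.sum_le_sum fun i (_ : i ∈ Finset.univ) => hterm i
    simp only [Finset.sum_add_distrib, ← Finset.mul_sum, Finset.sum_const, Finset.card_univ,
      Fintype.card_fin, nsmul_eq_mul] at hsum
    simp only [hg]
    linarith)
  have h0 : synthesis q (Z 0 - z 0) = 0 := by
    simp [synthesis, hz.zero, hZ.zero]
  have hmono : ∫ τ in (0 : ℝ)..t, g τ ≤ ∫ τ in (0 : ℝ)..s, g τ :=
    intervalIntegral.integral_mono_interval le_rfl ht.1 ht.2
      (Eventually.of_forall hg0) Jg
  rw [h0] at key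
  rw [← hgi]
  simp only [norm_zero] at key
  linarith

/-- Both paths start at `0`, so derivatives of the objective in `t` are compared. Along either path
the derivative is `∑ fᵢ' slackᵢ - ⟪b, Gf - tb⟫`; the sum vanishes for `z` and is small for `Z`, and
the other terms differ by `⟪b, G(z - Z)⟫`. -/
theorem scaledLasso_sub_le (hs : 0 < s) (hz : IsLassoPath q b s z)
    (hZ : IsMonotonePath q b s η κ θ B Z X) (hκ : 0 ≤ κ) (hθ : 0 ≤ θ) (hB : 0 ≤ B)
    (hh : 0 ≤ h) (hη : ∀ i, |η i| ≤ h) :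
    scaledLasso q b s (Z s) - scaledLasso q b s (z s) ≤
      s * (d * κ) + h * ∑ i, Z s i + s * (‖b‖ * √(2 * energyBound s κ θ B h z Z)) := by
  have I3 : ∀ i, IntervalIntegrable (fun t => X t i) volume 0 s := fun i =>
    (hZ.cont i).intervalIntegrable _ _
  have J3 : IntervalIntegrable (fun t => ∑ i, X t i) volume 0 s := by
    simpa only [Finset.sum_fn] using IntervalIntegrable.sum Finset.univ fun i _ => I3 i
  set A := ‖b‖ * √(2 * energyBound s κ θ B h z Z) with hA
  have K3 := J3.const_mul h
  have K0 : IntervalIntegrable (fun _ : ℝ => (d * κ + A : ℝ)) volume 0 s :=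
    intervalIntegrable_const
  have hid : AbsolutelyContinuousOnInterval (fun t : ℝ => t • b) 0 s :=
    (contDiffOn_id.smul contDiffOn_const).absolutelyContinuousOnInterval
  have hacS : ∀ f : ℝ → Fin d → ℝ, (∀ i, AbsolutelyContinuousOnInterval (fun t => f t i) 0 s) →
      AbsolutelyContinuousOnInterval (fun t => scaledLasso q b t (f t)) 0 s := fun f hf =>
    ((AbsolutelyContinuousOnInterval.norm_sq ((ac_synthesis hf).fun_sub hid)).const_mul
      (1 / 2)).fun_add (AbsolutelyContinuousOnInterval.sum _ fun i _ => hf i)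
  have hdS : ∀ (f : ℝ → Fin d → ℝ) (f' : Fin d → ℝ) (t : ℝ),
      (∀ i, HasDerivAt (fun t => f t i) (f' i) t) →
      HasDerivAt (fun t => scaledLasso q b t (f t))
        (∑ i, f' i * slack q b t (f t) i - inner ℝ b (synthesis q (f t) - t • b)) t := by
    intro f f' t hf
    have h1 := (hasDerivAt_synthesis q hf).sub ((hasDerivAt_id t).smul_const b)
    have h2 := (h1.norm_sq.const_mul (1 / 2)).add
      (HasDerivAt.fun_sum fun i (_ : i ∈ Finset.univ) => hf i)
    refine h2.congr_deriv ?_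
    simp only [slack, mul_add, mul_one, Finset.sum_add_distrib, ← inner_synthesis_left, id,
      Pi.sub_apply, one_smul]
    rw [real_inner_comm, inner_sub_left]
    ring
  have key := ((hacS Z fun i => hZ.ac i 0 s).fun_sub (hacS z hz.ac)).sub_le_integral hs.le
    (K0.add K3) (by
    filter_upwards [hz.ae_deriv hs] with t ht hts
    rw [((hdS Z (X t) t fun i => hZ.hasDeriv i t).fun_sub
      (hdS z _ t fun i => (ht hts i).1)).deriv]
    have e0 : ∑ i, deriv (fun t => z t i) t * slack q b t (z t) i = 0 :=
      Finset.sum_eq_zero fun i _ => (ht hts i).2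
    have e1 : ∑ i, X t i * slack q b t (Z t) i ≤ d * κ + h * ∑ i, X t i := by
      have hsum := Finset.sum_le_sum fun i (_ : i ∈ Finset.univ) =>
        show X t i * slack q b t (Z t) i ≤ κ + h * X t i by
          have c6 : X t i * η i ≤ X t i * h :=
            mul_le_mul_of_nonneg_left ((le_abs_self _).trans (hη i)) (hZ.nonneg t i)
          linarith [hZ.mul_le t hts i]
      simpa only [Finset.sum_add_distrib, ← Finset.mul_sum, Finset.sum_const, Finset.card_univ,
        Fintype.card_fin, nsmul_eq_mul] using hsum
    have e2 : inner ℝ b (synthesis q (z t) - t • b) - inner ℝ b (synthesis q (Z t) - t • b)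
        ≤ A := by
      rw [← inner_sub_right, sub_sub_sub_cancel_right, ← synthesis_sub]
      refine (real_inner_le_norm _ _).trans (mul_le_mul_of_nonneg_left ?_ (norm_nonneg b))
      refine Real.le_sqrt_of_sq_le ?_
      have := half_sq_norm_sub_le hs hz hZ hκ hθ hB hh hη (Ioo_subset_Icc_self hts)
      rw [synthesis_sub, norm_sub_rev, ← synthesis_sub]
      linarith
    rw [e0]
    linarith)
  rw [intervalIntegral.integral_add K0 K3, intervalIntegral.integral_const_mul,
    intervalIntegral.integral_finsetSum fun i _ => I3 i] at key
  simp only [hZ.integral_eq, intervalIntegral.integral_const, sub_zero, smul_eq_mul] at key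
  have h0 : scaledLasso q b 0 (Z 0) = scaledLasso q b 0 (z 0) := by
    rw [show Z 0 = z 0 from funext fun i => by rw [hZ.zero, hz.zero]]
  rw [h0] at key
  linarith

end Comparison

end DLN

/-! ### Estimates for the rescaled flow, uniform in `L` -/

namespace DLN

section Flow

variable {d n : ℕ} {q : Fin d → EuclideanSpace ℝ (Fin n)} {b : EuclideanSpace ℝ (Fin n)}

/-- The squared gradient flow, in the time scale `t = (L / 4) s` with `L = log (1 / ε)`, started at
`ε a`. -/
structure IsRescaledFlow (q : Fin d → EuclideanSpace ℝ (Fin n)) (b : EuclideanSpace ℝ (Fin n))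
    (a : Fin d → ℝ) (L : ℝ) (X : ℝ → Fin d → ℝ) : Prop where
  cont : ∀ i, Continuous fun t => X t i
  nonneg : ∀ t i, 0 ≤ X t i
  init : ∀ i, X 0 i = Real.exp (-L) * a i
  hasDeriv : ∀ i t, 0 < t →
    HasDerivAt (fun t => X t i) (-L * (X t i * inner ℝ (q i) (synthesis q (X t) - b))) t

/-- The primitive of a path that vanishes at time `0`. -/
noncomputable def primitive (X : ℝ → Fin d → ℝ) (t : ℝ) (i : Fin d) : ℝ := ∫ τ in (0 : ℝ)..t, X τ i

/-- A bound on the residual `‖G X - b‖` along the flow. -/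
noncomputable def residualBound (q : Fin d → EuclideanSpace ℝ (Fin n))
    (b : EuclideanSpace ℝ (Fin n)) (a : Fin d → ℝ) : ℝ :=
  ∑ i, |a i| * ‖q i‖ + ‖b‖

theorem residualBound_nonneg (q : Fin d → EuclideanSpace ℝ (Fin n))
    (b : EuclideanSpace ℝ (Fin n)) (a : Fin d → ℝ) : 0 ≤ residualBound q b a := by
  unfold residualBound
  positivity

/-- A bound on `∑ᵢ Zᵢ(s)` that does not depend on `L`. -/
noncomputable def massBound (q : Fin d → EuclideanSpace ℝ (Fin n)) (b : EuclideanSpace ℝ (Fin n))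
    (a : Fin d → ℝ) (s : ℝ) : ℝ :=
  2 * ((d + ‖b‖ * (residualBound q b a * s)) * s)

/-- A constant `c` for which the flow stays below `c L`. -/
noncomputable def growthConst (q : Fin d → EuclideanSpace ℝ (Fin n)) (b : EuclideanSpace ℝ (Fin n))
    (a : Fin d → ℝ) (s : ℝ) : ℝ :=
  1 + ∑ i, |a i| + (∑ i, ‖q i‖) * residualBound q b a * massBound q b a s

variable {a : Fin d → ℝ} {L s t : ℝ} {X : ℝ → Fin d → ℝ}

theorem massBound_nonneg (hs : 0 ≤ s) : 0 ≤ massBound q b a s := by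
  have := residualBound_nonneg q b a
  unfold massBound
  positivity

theorem one_le_growthConst (hs : 0 ≤ s) : 1 ≤ growthConst q b a s := by
  have h1 := residualBound_nonneg q b a
  have h2 := massBound_nonneg (q := q) (b := b) (a := a) hs
  have : 0 ≤ ∑ i, |a i| + (∑ i, ‖q i‖) * residualBound q b a * massBound q b a s := by positivity
  unfold growthConst
  linarith

namespace IsRescaledFlow

theorem continuous_path (hX : IsRescaledFlow q b a L X) : Continuous X :=
  continuous_pi hX.cont

/-- The flow decreases the loss: `‖GX - b‖²` has derivative `-2L ∑ Xᵢ ⟪qᵢ, GX - b⟫²`. The initial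
value is bounded uniformly because `exp(-L) ≤ 1`. -/
theorem norm_residual_le (hX : IsRescaledFlow q b a L X) (hL : 0 ≤ L) (ht : 0 ≤ t) :
    ‖synthesis q (X t) - b‖ ≤ residualBound q b a := by
  have hcont : Continuous fun t => ‖synthesis q (X t) - b‖ ^ 2 :=
    (((continuous_synthesis q).comp hX.continuous_path).sub continuous_const).norm.pow 2
  have hder : ∀ t, 0 < t → HasDerivAt (fun t => ‖synthesis q (X t) - b‖ ^ 2) _ t := fun t ht =>
    ((hasDerivAt_synthesis q fun i => hX.hasDeriv i t ht).sub_const b).norm_sq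
  have hanti : AntitoneOn (fun t => ‖synthesis q (X t) - b‖ ^ 2) (Ici 0) := by
    refine antitoneOn_of_deriv_nonpos (convex_Ici 0) hcont.continuousOn ?_ ?_
    · rw [interior_Ici]
      exact fun t ht => (hder t ht).differentiableAt.differentiableWithinAt
    · rw [interior_Ici]
      intro t ht
      rw [(hder t ht).deriv, real_inner_comm, inner_synthesis_left]
      have : ∑ i, -L * (X t i * inner ℝ (q i) (synthesis q (X t) - b)) *
          inner ℝ (q i) (synthesis q (X t) - b) ≤ 0 := by
        refine Finset.sum_nonpos fun i _ => ?_
        have := mul_nonneg hL (mul_nonneg (hX.nonneg t i)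
          (sq_nonneg (inner ℝ (q i) (synthesis q (X t) - b))))
        linarith
      linarith
  have h1 : ‖synthesis q (X t) - b‖ ≤ ‖synthesis q (X 0) - b‖ :=
    (pow_le_pow_iff_left₀ (norm_nonneg _) (norm_nonneg _) two_ne_zero).1
      (hanti self_mem_Ici ht ht)
  refine h1.trans ((norm_sub_le _ _).trans ?_)
  unfold residualBound
  gcongr
  refine (norm_synthesis_le q _).trans
    (Finset.sum_le_sum fun i _ => mul_le_mul_of_nonneg_right ?_ (norm_nonneg _))
  rw [hX.init, abs_mul, abs_of_pos (Real.exp_pos _)]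
  exact mul_le_of_le_one_left (abs_nonneg _) (Real.exp_le_one_iff.2 (by linarith))

theorem hasDerivAt_primitive (hX : IsRescaledFlow q b a L X) (i : Fin d) (t : ℝ) :
    HasDerivAt (fun t => primitive X t i) (X t i) t :=
  (hX.cont i).integral_hasStrictDerivAt 0 t |>.hasDerivAt

theorem primitive_zero (X : ℝ → Fin d → ℝ) : primitive X 0 = 0 := by
  ext i
  simp [primitive]

theorem primitive_nonneg (hX : IsRescaledFlow q b a L X) (ht : 0 ≤ t) (i : Fin d) :
    0 ≤ primitive X t i :=
  intervalIntegral.integral_nonneg ht fun τ _ => hX.nonneg τ i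

theorem hasDerivAt_dual (hX : IsRescaledFlow q b a L X) (t : ℝ) :
    HasDerivAt (fun t => synthesis q (primitive X t) - t • b) (synthesis q (X t) - b) t := by
  simpa using (hasDerivAt_synthesis q fun i => hX.hasDerivAt_primitive i t).fun_sub
    ((hasDerivAt_id t).smul_const b)

theorem norm_dual_le (hX : IsRescaledFlow q b a L X) (hL : 0 ≤ L) (ht : 0 ≤ t) :
    ‖synthesis q (primitive X t) - t • b‖ ≤ residualBound q b a * t := by
  have := (convex_Icc 0 t).norm_image_sub_le_of_norm_hasDerivWithin_le
    (fun x _ => (hX.hasDerivAt_dual x).hasDerivWithinAt)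
    (fun x hx => hX.norm_residual_le hL hx.1) (left_mem_Icc.2 ht) (right_mem_Icc.2 ht)
  simpa [primitive_zero, synthesis, abs_of_nonneg ht] using this

theorem eq_exp (hX : IsRescaledFlow q b a L X) (hL : 0 < L) (ha : ∀ i, 0 < a i) (ht : 0 ≤ t)
    (i : Fin d) :
    X t i = Real.exp (-(L * (slack q b t (primitive X t) i - Real.log (a i) / L))) := by
  set Q : ℝ → ℝ := fun t => inner ℝ (q i) (synthesis q (primitive X t) - t • b) with hQ
  have hQd : ∀ t, HasDerivAt Q (inner ℝ (q i) (synthesis q (X t) - b)) t := fun t => by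
    simpa using (hasDerivAt_const t (q i)).inner ℝ (hX.hasDerivAt_dual t)
  have hQ0 : Q 0 = 0 := by simp [hQ, primitive_zero, synthesis]
  -- A conserved quantity; this form avoids `log X`, hence any prior positivity of `X`.
  have hconst : X t i * Real.exp (L * Q t) = Real.exp (-L) * a i := by
    rcases ht.eq_or_lt with rfl | ht
    · rw [hQ0, hX.init]; simp
    have hc : Continuous fun t => X t i * Real.exp (L * Q t) := by
      have : Continuous Q := continuous_iff_continuousAt.2 fun t => (hQd t).continuousAt
      have := hX.cont i
      fun_prop
    have hd : ∀ τ ∈ Ioo 0 t, HasDerivAt (fun t => X t i * Real.exp (L * Q t)) 0 τ := by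
      intro τ hτ
      refine ((hX.hasDeriv i τ hτ.1).mul ((hQd τ).const_mul L).exp).congr_deriv ?_
      ring
    obtain ⟨c, -, hc⟩ := exists_hasDerivAt_eq_slope _ (fun _ => 0) ht hc.continuousOn hd
    rw [eq_comm, div_eq_zero_iff, sub_zero] at hc
    have := hc.resolve_right ht.ne'
    rw [hQ0, hX.init] at this
    simp only [mul_zero, Real.exp_zero, mul_one] at this
    linarith
  have : L * (slack q b t (primitive X t) i - Real.log (a i) / L) =
      L + L * Q t - Real.log (a i) := by
    simp only [slack, hQ]
    field_simp
  rw [this, show -(L + L * Q t - Real.log (a i)) = -L + Real.log (a i) + -(L * Q t) by ring,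
    Real.exp_add, Real.exp_add, Real.exp_log (ha i), ← hconst, mul_assoc, ← Real.exp_add]
  simp

/-- Since `X = exp(-L w)`, this is `y ≤ exp y` at `y = L w`. -/
theorem mul_slack_le (hX : IsRescaledFlow q b a L X) (hL : 0 < L) (ha : ∀ i, 0 < a i) (ht : 0 ≤ t)
    (i : Fin d) :
    X t i * (slack q b t (primitive X t) i - Real.log (a i) / L) ≤ 1 / L := by
  rw [hX.eq_exp hL ha ht i]
  set w := slack q b t (primitive X t) i - Real.log (a i) / L
  rw [le_div_iff₀ hL, Real.exp_neg, mul_assoc, inv_mul_le_iff₀ (Real.exp_pos _), mul_one, mul_comm]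
  linarith [Real.add_one_le_exp (L * w)]

theorem slack_le (hX : IsRescaledFlow q b a L X) (hL : 0 ≤ L) (ht : 0 ≤ t) (i : Fin d) :
    slack q b t (primitive X t) i ≤ 1 + (∑ i, ‖q i‖) * residualBound q b a * t := by
  unfold slack
  gcongr
  refine (real_inner_le_norm _ _).trans ?_
  rw [mul_assoc]
  refine mul_le_mul (Finset.single_le_sum (f := fun i => ‖q i‖) (fun i _ => norm_nonneg _)
    (Finset.mem_univ i)) (hX.norm_dual_le hL ht) (norm_nonneg _) (by positivity)

theorem sum_primitive_le (hX : IsRescaledFlow q b a L X) (hL : 1 ≤ L) (ha : ∀ i, 0 < a i)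
    (hs : 0 ≤ s) (hη : ∀ i, |Real.log (a i) / L| ≤ 1 / 2) :
    ∑ i, primitive X s i ≤ massBound q b a s := by
  have hL0 : 0 < L := by linarith
  -- The scaled objective with weights `1 - ηᵢ`, chosen so that its derivative contains exactly the
  -- products `Xᵢ wᵢ ≤ 1/L`. As `ηᵢ ≤ 1/2`, it controls half the mass.
  set f : ℝ → ℝ := fun t => 1 / 2 * ‖synthesis q (primitive X t) - t • b‖ ^ 2 +
    ∑ i, (1 - Real.log (a i) / L) * primitive X t i with hf
  have hd : ∀ t, HasDerivAt f (∑ i, X t i * (slack q b t (primitive X t) i - Real.log (a i) / L)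
      - inner ℝ b (synthesis q (primitive X t) - t • b)) t := by
    intro t
    have h2 := ((hX.hasDerivAt_dual t).norm_sq.const_mul (1 / 2)).add
      (HasDerivAt.fun_sum fun i (_ : i ∈ Finset.univ) =>
        (hX.hasDerivAt_primitive i t).const_mul (1 - Real.log (a i) / L))
    refine h2.congr_deriv ?_
    rw [real_inner_comm, inner_sub_left, inner_synthesis_left]
    simp only [slack]
    have : ∑ i, X t i * (1 + inner ℝ (q i) (synthesis q (primitive X t) - t • b)
        - Real.log (a i) / L) = ∑ i, X t i * inner ℝ (q i) (synthesis q (primitive X t) - t • b)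
        + ∑ i, (1 - Real.log (a i) / L) * X t i := by
      rw [← Finset.sum_add_distrib]
      exact Finset.sum_congr rfl fun i _ => by ring
    rw [this]
    ring
  have hub : ∀ t ∈ Icc 0 s, deriv f t ≤ d + ‖b‖ * (residualBound q b a * s) := by
    intro t ht
    rw [(hd t).deriv]
    have h1 : ∑ i, X t i * (slack q b t (primitive X t) i - Real.log (a i) / L) ≤ d := by
      refine (Finset.sum_le_sum fun i _ => (hX.mul_slack_le hL0 ha ht.1 i).trans
        ((div_le_one hL0).2 hL)).trans ?_
      simp
    have h2 : -inner ℝ b (synthesis q (primitive X t) - t • b) ≤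
        ‖b‖ * (residualBound q b a * s) := by
      refine (neg_le_abs _).trans ((abs_real_inner_le_norm _ _).trans ?_)
      have := residualBound_nonneg q b a
      gcongr
      exact (hX.norm_dual_le hL0.le ht.1).trans (by gcongr; exact ht.2)
    linarith
  have key := (convex_Icc 0 s).image_sub_le_mul_sub_of_deriv_le
    (f := f) (fun t _ => (hd t).continuousAt.continuousWithinAt)
    (fun t _ => (hd t).differentiableAt.differentiableWithinAt)
    (fun t ht => hub t (interior_subset ht)) 0 (left_mem_Icc.2 hs) s (right_mem_Icc.2 hs) hs
  have h0 : f 0 = 0 := by simp [hf, primitive_zero, synthesis]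
  have h1 : 1 / 2 * ∑ i, primitive X s i ≤ f s := by
    have : 1 / 2 * ∑ i, primitive X s i ≤ ∑ i, (1 - Real.log (a i) / L) * primitive X s i := by
      rw [Finset.mul_sum]
      refine Finset.sum_le_sum fun i _ => mul_le_mul_of_nonneg_right ?_ (hX.primitive_nonneg hs i)
      linarith [(le_abs_self _).trans (hη i)]
    have := sq_nonneg ‖synthesis q (primitive X s) - s • b‖
    simp only [hf]
    linarith
  unfold massBound
  linarith

/-- From `X' ≤ L K X = L K Z'`, the function `X - L K Z` is nonincreasing, and `Z` is bounded
uniformly in `L`. Growth linear in `L` is what makes `θ = log(cL)/L` vanish; Grönwall would only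
give an exponential bound. -/
theorem le_growthConst_mul (hX : IsRescaledFlow q b a L X) (hL : 1 ≤ L) (ha : ∀ i, 0 < a i)
    (hs : 0 ≤ s) (hη : ∀ i, |Real.log (a i) / L| ≤ 1 / 2) (ht : t ∈ Icc 0 s) (i : Fin d) :
    X t i ≤ growthConst q b a s * L := by
  have hL0 : 0 < L := by linarith
  have hR := residualBound_nonneg q b a
  set K := (∑ i, ‖q i‖) * residualBound q b a with hK
  have hK0 : 0 ≤ K := by positivity
  have hd : ∀ t, 0 < t → HasDerivAt (fun t => X t i - L * K * primitive X t i) _ t := fun t ht =>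
    (hX.hasDeriv i t ht).fun_sub ((hX.hasDerivAt_primitive i t).const_mul (L * K))
  have hanti : AntitoneOn (fun t => X t i - L * K * primitive X t i) (Ici 0) := by
    refine antitoneOn_of_deriv_nonpos (convex_Ici 0) ?_ ?_ ?_
    · have : Continuous fun t => primitive X t i :=
        continuous_iff_continuousAt.2 fun t => (hX.hasDerivAt_primitive i t).continuousAt
      exact ((hX.cont i).sub (continuous_const.mul this)).continuousOn
    · rw [interior_Ici]
      exact fun t ht => (hd t ht).differentiableAt.differentiableWithinAt
    · rw [interior_Ici]
      intro t ht
      rw [(hd t ht).deriv]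
      have h1 : -inner ℝ (q i) (synthesis q (X t) - b) ≤ K :=
        (neg_le_abs _).trans ((abs_real_inner_le_norm _ _).trans
          (mul_le_mul (Finset.single_le_sum (f := fun i => ‖q i‖) (fun i _ => norm_nonneg _)
            (Finset.mem_univ i)) (hX.norm_residual_le hL0.le (le_of_lt ht)) (norm_nonneg _)
            (by positivity)))
      have := mul_le_mul_of_nonneg_left h1 (mul_nonneg hL0.le (hX.nonneg t i))
      linarith
  have h1 : X t i - L * K * primitive X t i ≤ X 0 i - L * K * primitive X 0 i :=
    hanti self_mem_Ici ht.1 ht.1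
  have h2 : X 0 i ≤ ∑ i, |a i| := by
    rw [hX.init, ← abs_of_pos (ha i)]
    refine (mul_le_of_le_one_left (abs_nonneg _) (Real.exp_le_one_iff.2 (by linarith))).trans ?_
    exact Finset.single_le_sum (f := fun i => |a i|) (fun i _ => abs_nonneg _) (Finset.mem_univ i)
  have h3 : primitive X t i ≤ massBound q b a s := by
    refine le_trans ?_ (hX.sum_primitive_le hL ha hs hη)
    refine le_trans ?_ (Finset.single_le_sum (f := fun i => primitive X s i)
      (fun i _ => hX.primitive_nonneg hs i) (Finset.mem_univ i))
    exact intervalIntegral.integral_mono_interval le_rfl ht.1 ht.2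
      (Eventually.of_forall fun τ => hX.nonneg τ i) ((hX.cont i).intervalIntegrable _ _)
  have h4 := mul_le_mul_of_nonneg_left h3 (mul_nonneg hL0.le hK0)
  have h5 : 0 ≤ ∑ i, |a i| := by positivity
  have h6 : ∑ i, |a i| ≤ (∑ i, |a i|) * L := le_mul_of_one_le_right h5 hL
  rw [primitive_zero] at h1
  simp only [Pi.zero_apply] at h1
  unfold growthConst
  rw [← hK]
  linarith

theorem isMonotonePath (hX : IsRescaledFlow q b a L X) (hL : 1 ≤ L) (ha : ∀ i, 0 < a i)
    (hs : 0 ≤ s) (hη : (∑ i, |Real.log (a i)|) / L ≤ 1 / 2) :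
    IsMonotonePath q b s (fun i => Real.log (a i) / L) (1 / L)
      (Real.log (growthConst q b a s * L) / L)
      (1 + (∑ i, ‖q i‖) * residualBound q b a * s + (∑ i, |Real.log (a i)|) / L)
      (primitive X) X := by
  have hL0 : 0 < L := by linarith
  have hη1 : ∀ i, |Real.log (a i) / L| ≤ (∑ i, |Real.log (a i)|) / L := fun i => by
    rw [abs_div, abs_of_pos hL0]
    gcongr
    exact Finset.single_le_sum (f := fun i => |Real.log (a i)|) (fun i _ => abs_nonneg _)
      (Finset.mem_univ i)
  refine ⟨hX.cont, hX.hasDerivAt_primitive, fun i => by rw [primitive_zero]; rfl, hX.nonneg,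
    fun t ht i => hX.mul_slack_le hL0 ha ht.1.le i, fun t ht i => ?_, fun t ht i => ?_⟩
  · have h1 := hX.le_growthConst_mul hL ha hs (fun i => (hη1 i).trans hη)
      (Ioo_subset_Icc_self ht) i
    rw [hX.eq_exp hL0 ha ht.1.le i] at h1
    have h2 := (Real.le_log_iff_exp_le ((Real.exp_pos _).trans_le h1)).2 h1
    rw [neg_le, le_div_iff₀ hL0]
    linarith
  · have h1 := hX.slack_le hL0.le ht.1.le i
    have h2 := (neg_le_abs _).trans (hη1 i)
    have h3 : (∑ i, ‖q i‖) * residualBound q b a * t ≤ (∑ i, ‖q i‖) * residualBound q b a * s := by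
      have := residualBound_nonneg q b a
      gcongr
      exact ht.2.le
    linarith

end IsRescaledFlow

end Flow

end DLN

/-! ### From the gradient flow and the lasso minimizers to the two paths -/

namespace DLN

section Lasso

variable {d n : ℕ} {M : Matrix (Fin d) (Fin d) ℝ} {r : EuclideanSpace ℝ (Fin d)}
  {q : Fin d → EuclideanSpace ℝ (Fin n)} {b : EuclideanSpace ℝ (Fin n)}

/-- The squared gradient flow in the rescaled time, extended by its initial value to negative
times. -/
noncomputable def rescaledFlow (u : ℝ → EuclideanSpace ℝ (Fin d)) (L t : ℝ) (i : Fin d) : ℝ :=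
  u (L / 4 * max t 0) i * u (L / 4 * max t 0) i

theorem IsGradientFlow.continuousOn {u₀ : EuclideanSpace ℝ (Fin d)}
    {u : ℝ → EuclideanSpace ℝ (Fin d)} (hu : IsGradientFlow M r u₀ u) : ContinuousOn u (Ici 0) :=
  fun t ht => (hu.deriv t ht).continuousWithinAt

theorem IsGradientFlow.isRescaledFlow
    (hl : ∀ x, loss M r x = 1 / 2 * ‖synthesis q x.ofLp - b‖ ^ 2 - 1 / 2 * ‖b‖ ^ 2)
    {α : EuclideanSpace ℝ (Fin d)} {ε L : ℝ} (hε : ε = Real.exp (-L)) (hL : 0 < L)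
    {u : ℝ → EuclideanSpace ℝ (Fin d)} (hu : IsGradientFlow M r (√ε • α) u) :
    IsRescaledFlow q b (fun i => α i * α i) L (rescaledFlow u L) := by
  have hc : Continuous fun t : ℝ => u (L / 4 * max t 0) :=
    hu.continuousOn.comp_continuous (by fun_prop) fun t =>
      show 0 ≤ L / 4 * max t 0 by positivity
  refine ⟨fun i => ?_, fun t i => mul_self_nonneg _, fun i => ?_, fun i t ht => ?_⟩
  · have : Continuous fun t : ℝ => u (L / 4 * max t 0) i :=
      (EuclideanSpace.proj i : EuclideanSpace ℝ (Fin d) →L[ℝ] ℝ).continuous.comp hc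
    exact this.mul this
  · have : √ε * √ε = ε := Real.mul_self_sqrt (hε ▸ (Real.exp_pos _).le)
    simp only [rescaledFlow, max_self, mul_zero, hu.init, PiLp.smul_apply, smul_eq_mul]
    rw [← hε]
    linear_combination (α i * α i) * this
  · have ht4 : 0 < L / 4 * t := by positivity
    have h1 := (hu.deriv _ ht4.le).hasDerivAt (Ici_mem_nhds ht4)
    have h2 : HasDerivAt (fun t => u t i)
        (-(gradient (fun v => loss M r (hadamardSq v)) (u (L / 4 * t)) i)) (L / 4 * t) :=
      (EuclideanSpace.proj i : EuclideanSpace ℝ (Fin d) →L[ℝ] ℝ).hasFDerivAt.comp_hasDerivAt _ h1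
    have h3 : HasDerivAt (fun t => u (L / 4 * t) i) _ t :=
      h2.comp t ((hasDerivAt_id t).const_mul (L / 4))
    -- Squaring `u` gives a factor `2` and the gradient of `ℓ(u²)` another; their product cancels
    -- the `1/4` of the time scale.
    have h4 := h3.mul h3
    have hev : (fun t => rescaledFlow u L t i) =ᶠ[𝓝 t]
        fun t => u (L / 4 * t) i * u (L / 4 * t) i := by
      filter_upwards [Ioi_mem_nhds ht] with τ hτ
      rw [rescaledFlow, max_eq_left (le_of_lt hτ)]
    refine (h4.congr_of_eventuallyEq hev).congr_deriv ?_
    have e : synthesis q (rescaledFlow u L t) =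
        synthesis q (hadamardSq (u (L / 4 * t))).ofLp := by
      congr 1
      ext i
      simp [rescaledFlow, max_eq_left ht.le, hadamardSq]
    rw [e, hev.eq_of_nhds]
    simp only [gradient_loss_hadamardSq hl, mul_one]
    ring

theorem IsGradientFlow.timeAverage_apply {u₀ : EuclideanSpace ℝ (Fin d)}
    {u : ℝ → EuclideanSpace ℝ (Fin d)} (hu : IsGradientFlow M r u₀ u) {L s : ℝ} (hL : 0 < L)
    (hs : 0 < s) (i : Fin d) :
    timeAverage (fun t => hadamardSq (u t)) (L / 4 * s) i =
      1 / s * primitive (rescaledFlow u L) s i := by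
  have hT : 0 ≤ L / 4 * s := by positivity
  have hcu : ∀ i, ContinuousOn (fun t => u t i) (uIcc 0 (L / 4 * s)) := fun i => by
    rw [uIcc_of_le hT]
    exact (EuclideanSpace.proj i : EuclideanSpace ℝ (Fin d) →L[ℝ] ℝ).continuous.comp_continuousOn
      (hu.continuousOn.mono Icc_subset_Ici_self)
  have hint : IntervalIntegrable (fun t => hadamardSq (u t)) volume 0 (L / 4 * s) := by
    refine ContinuousOn.intervalIntegrable ?_
    exact (PiLp.continuous_toLp 2 _).comp_continuousOn
      (continuousOn_pi.2 fun i => (hcu i).mul (hcu i))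
  have h1 : (∫ t in (0 : ℝ)..(L / 4 * s), hadamardSq (u t)) i =
      ∫ t in (0 : ℝ)..(L / 4 * s), u t i * u t i :=
    ((EuclideanSpace.proj i : EuclideanSpace ℝ (Fin d) →L[ℝ] ℝ).intervalIntegral_comp_comm
      hint).symm
  have h2 : primitive (rescaledFlow u L) s i =
      ∫ t in (0 : ℝ)..s, u (L / 4 * t) i * u (L / 4 * t) i := by
    refine intervalIntegral.integral_congr fun t ht => ?_
    rw [uIcc_of_le hs.le] at ht
    simp only [rescaledFlow, max_eq_left ht.1]
  have h3 := intervalIntegral.integral_comp_mul_left (a := 0) (b := s)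
    (fun t => u t i * u t i) (c := L / 4) (by positivity)
  rw [h2, h3, timeAverage, PiLp.smul_apply, h1, mul_zero, smul_eq_mul, smul_eq_mul]
  field_simp

theorem lasso_eq_scaledLasso
    (hl : ∀ x, loss M r x = 1 / 2 * ‖synthesis q x.ofLp - b‖ ^ 2 - 1 / 2 * ‖b‖ ^ 2)
    {y : EuclideanSpace ℝ (Fin d)} {z : Fin d → ℝ} {s : ℝ} (hs : 0 < s) (hz : ∀ i, 0 ≤ z i)
    (hy : ∀ i, y i = 1 / s * z i) :
    lasso M r y (1 / s) = scaledLasso q b s z / s ^ 2 - 1 / 2 * ‖b‖ ^ 2 := by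
  have hy0 : ∀ i, 0 ≤ y i := fun i => by rw [hy]; have := hz i; positivity
  have e1 : synthesis q y.ofLp - b = (1 / s) • (synthesis q z - s • b) := by
    rw [show y.ofLp = fun i => 1 / s * z i from funext hy, synthesis_smul, smul_sub, smul_smul,
      one_div_mul_cancel hs.ne', one_smul]
  rw [lasso_of_nonneg hl hy0, e1, norm_smul, scaledLasso, mul_pow, Real.norm_eq_abs, sq_abs]
  simp only [hy, ← Finset.mul_sum]
  field_simp
  ring

/-- The optimality conditions at penalty `1/t`, multiplied by `t`, are those of the scaled problem.
-/
theorem isLassoPath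
    (hl : ∀ x, loss M r x = 1 / 2 * ‖synthesis q x.ofLp - b‖ ^ 2 - 1 / 2 * ‖b‖ ^ 2)
    {x : ℝ → EuclideanSpace ℝ (Fin d)}
    (hx : ∀ s : ℝ, 0 < s → IsPosLassoMinimizer M r (1 / s) (x s))
    (hac : ∀ a b : ℝ, 0 < a → a ≤ b → AbsolutelyContinuousOnInterval x a b)
    {s : ℝ} (hs : 0 < s) : IsLassoPath q b s fun t i => t * x t i := by
  have hslack : ∀ t : ℝ, 0 < t → ∀ i, slack q b t (fun i => t * x t i) i =
      t * (inner ℝ (q i) (synthesis q (x t).ofLp - b) + 1 / t) := fun t ht i => by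
    rw [slack, synthesis_smul, ← smul_sub, real_inner_smul_right]
    field_simp
    ring
  refine ⟨fun i => ?_, fun i => zero_mul _, fun t ht i => mul_nonneg ht.1.le ((hx t ht.1).1 i),
    fun t ht i => ?_, fun t ht i hne => ?_⟩
  · set R := ∑ i, ‖q i‖ * ‖b‖ with hR
    have hR0 : 0 ≤ R := by positivity
    -- For `0 < t ≤ t₀` the penalty `1/t` exceeds `R`, so the path is zero up to `t₀`.
    set t₀ := min s (1 / (R + 1)) with ht0
    have ht0p : 0 < t₀ := lt_min hs (by positivity)
    refine AbsolutelyContinuousOnInterval.of_eq_zero ht0p.le (min_le_left _ _) (fun t ht => ?_) ?_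
    · rcases ht.1.eq_or_lt with rfl | htp
      · exact zero_mul _
      · have : R < 1 / t := by
          have : t ≤ 1 / (R + 1) := ht.2.trans (min_le_right _ _)
          rw [le_div_iff₀ (by positivity)] at this
          rw [lt_div_iff₀ htp]
          nlinarith
        rw [(hx t htp).eq_zero_of_large hl this i, mul_zero]
    · have h1 : AbsolutelyContinuousOnInterval (fun t => x t i) t₀ s :=
        (hac t₀ s ht0p (min_le_left _ _)).clm_comp
          (EuclideanSpace.proj i : EuclideanSpace ℝ (Fin d) →L[ℝ] ℝ)
      have h2 : AbsolutelyContinuousOnInterval (fun t : ℝ => t) t₀ s :=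
        contDiffOn_id.absolutelyContinuousOnInterval
      exact h2.fun_mul h1
  · rw [hslack t ht.1]
    exact mul_nonneg ht.1.le ((hx t ht.1).stationarity_nonneg hl i)
  · rw [hslack t ht.1]
    have hxi : 0 < x t i :=
      lt_of_le_of_ne ((hx t ht.1).1 i) fun h => hne (by simp [← h])
    rw [(hx t ht.1).stationarity_eq_zero hl i hxi, mul_zero]

end Lasso

/-- The bound on the scaled suboptimality gap, in terms of the errors `κ`, `h`, `θ`. -/
noncomputable def gapBound (d : ℕ) (s β K m zd V κ h θ : ℝ) : ℝ :=
  s * (d * κ) + h * m +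
    s * (β * √(2 * (s * (d * κ) + (1 + K * s + h) * zd + (θ + h) * V + h * m)))

/-- All three errors vanish because `log L / L → 0`; only the term carrying `zd` survives. -/
theorem tendsto_gapBound (d : ℕ) (s β K m zd V A c : ℝ) (hc : 0 < c) :
    Tendsto (fun L : ℝ => gapBound d s β K m zd V (1 / L) (A / L) (Real.log (c * L) / L)) atTop
      (𝓝 (s * (β * √(2 * ((1 + K * s) * zd))))) := by
  have h1 : Tendsto (fun L : ℝ => 1 / L) atTop (𝓝 0) := tendsto_const_nhds.div_atTop tendsto_id
  have h2 : Tendsto (fun L : ℝ => A / L) atTop (𝓝 0) := tendsto_const_nhds.div_atTop tendsto_id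
  have h3 : Tendsto (fun L : ℝ => Real.log (c * L) / L) atTop (𝓝 0) := by
    have h4 : Tendsto (fun L : ℝ => Real.log c / L + Real.log L / L) atTop (𝓝 (0 + 0)) :=
      (tendsto_const_nhds.div_atTop tendsto_id).add
        Real.isLittleO_log_id_atTop.tendsto_div_nhds_zero
    rw [add_zero] at h4
    refine h4.congr' ?_
    filter_upwards [eventually_gt_atTop 0] with L hL
    rw [Real.log_mul hc.ne' hL.ne', add_div]
  have hcont : Continuous fun p : ℝ × ℝ × ℝ => gapBound d s β K m zd V p.1 p.2.1 p.2.2 := by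
    unfold gapBound
    fun_prop
  have := (hcont.tendsto (0, 0, 0)).comp (h1.prodMk_nhds (h2.prodMk_nhds h3))
  simpa [gapBound, Function.comp_def] using this

end DLN

/-! ### The limit of vanishing initialization -/

theorem theorem4 (d : ℕ) (M : Matrix (Fin d) (Fin d) ℝ) (hM : M.PosSemidef)
    (r : EuclideanSpace ℝ (Fin d)) (hr : r ∈ LinearMap.range M.toEuclideanLin)
    (α : EuclideanSpace ℝ (Fin d)) (hα : ∀ i, α i ≠ 0) :
    ∃ C : ℝ, 0 < C ∧
      ∀ u : ℝ → ℝ → EuclideanSpace ℝ (Fin d),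
        (∀ ε : ℝ, 0 < ε → ε < 1 → DLN.IsGradientFlow M r (√ε • α) (u ε)) →
      ∀ x : ℝ → EuclideanSpace ℝ (Fin d),
        (∀ s : ℝ, 0 < s → DLN.IsPosLassoMinimizer M r (1 / s) (x s)) →
        (∀ a b : ℝ, 0 < a → a ≤ b → AbsolutelyContinuousOnInterval x a b) →
      ∀ s : ℝ, 0 < s →
        Filter.limsup
            (fun ε : ℝ =>
              ((DLN.lasso M r
                (DLN.timeAverage (fun t => DLN.hadamardSq (u ε t)) (DLN.unscaledTime ε s))
                (1 / s) : ℝ) : EReal))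
            (nhdsWithin 0 (Set.Ioi 0))
          ≤ ((DLN.posLassoMin M r (1 / s)
              + C * (√(1 + s) / s * √(DLN.zDown x s)
                + (1 + s) / s ^ 2 * DLN.zDown x s) : ℝ) : EReal) := by
  obtain ⟨n, q, b, hl⟩ := DLN.exists_leastSquares hM hr
  set a : Fin d → ℝ := fun i => α i * α i with ha
  have ha0 : ∀ i, 0 < a i := fun i => mul_self_pos.2 (hα i)
  set K := (∑ i, ‖q i‖) * DLN.residualBound q b a with hK
  have hK0 : 0 ≤ K := mul_nonneg (by positivity) (DLN.residualBound_nonneg q b a)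
  -- The constant comes from `1 + K s ≤ (1 + K)(1 + s)`; the added `1` only ensures positivity.
  refine ⟨‖b‖ * √(2 * (1 + K)) + 1, by positivity, fun u hu x hx hac s hs => ?_⟩
  have hz := DLN.isLassoPath hl hx hac hs
  set z : ℝ → Fin d → ℝ := fun t i => t * x t i with hzdef
  set zd := DLN.zDown x s with hzd
  have hzd' : zd = ∑ i, ∫ t in (0 : ℝ)..s, max (-deriv (fun t => z t i) t) 0 := rfl
  have hzd0 : 0 ≤ zd := Finset.sum_nonneg fun i _ =>
    intervalIntegral.integral_nonneg hs.le fun t _ => le_max_right _ _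
  set V := ∑ i, ∫ t in (0 : ℝ)..s, |deriv (fun t => z t i) t| with hV
  set m := DLN.massBound q b a s with hm
  set c := DLN.growthConst q b a s with hc
  have hc1 : 1 ≤ c := DLN.one_le_growthConst hs.le
  set A := ∑ i, |Real.log (a i)| with hA
  have hA0 : 0 ≤ A := by positivity
  -- An upper bound that depends on `ε` only through `L`, so its limit bounds the limsup.
  set G : ℝ → ℝ := fun L => DLN.posLassoMin M r (1 / s) +
    DLN.gapBound d s ‖b‖ K m zd V (1 / L) (A / L) (Real.log (c * L) / L) / s ^ 2 with hG
  have hlog : Tendsto (fun ε : ℝ => Real.log (1 / ε)) (𝓝[>] 0) atTop := by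
    simpa only [one_div, Function.comp_def] using
      Real.tendsto_log_atTop.comp tendsto_inv_nhdsGT_zero
  have hGlim : Tendsto G atTop (𝓝 (DLN.posLassoMin M r (1 / s) +
      s * (‖b‖ * √(2 * ((1 + K * s) * zd))) / s ^ 2)) :=
    ((DLN.tendsto_gapBound d s ‖b‖ K m zd V A c (by linarith)).div_const _).const_add _
  have hle : ∀ᶠ ε : ℝ in 𝓝[>] 0, DLN.lasso M r
      (DLN.timeAverage (fun t => DLN.hadamardSq (u ε t)) (DLN.unscaledTime ε s)) (1 / s) ≤
      G (Real.log (1 / ε)) := by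
    -- `L ≥ 2A` gives `|ηᵢ| ≤ 1/2`, as the mass bound requires.
    filter_upwards [hlog.eventually_ge_atTop (max 1 (2 * A)), Ioo_mem_nhdsGT one_pos] with ε hε hε1
    set L := Real.log (1 / ε) with hLdef
    have hL1 : 1 ≤ L := (le_max_left _ _).trans hε
    have hL0 : 0 < L := by linarith
    have hεL : ε = Real.exp (-L) := by
      rw [hLdef, one_div, Real.log_inv, neg_neg, Real.exp_log hε1.1]
    have hη : A / L ≤ 1 / 2 := by
      rw [div_le_iff₀ hL0]
      linarith [(le_max_right _ _).trans hε]
    have hη1 : ∀ i, |Real.log (a i) / L| ≤ A / L := fun i => by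
      rw [abs_div, abs_of_pos hL0]
      gcongr
      exact Finset.single_le_sum (f := fun i => |Real.log (a i)|) (fun i _ => abs_nonneg _)
        (Finset.mem_univ i)
    have hflow := hu ε hε1.1 hε1.2
    have hX := hflow.isRescaledFlow hl hεL hL0
    have hmono := hX.isMonotonePath hL1 ha0 hs.le hη
    have hgap := DLN.scaledLasso_sub_le hs hz hmono (by positivity)
      (div_nonneg (Real.log_nonneg (by nlinarith)) hL0.le) (by positivity) (by positivity) hη1
    have hmass : ∑ i, DLN.primitive (DLN.rescaledFlow (u ε) L) s i ≤ m :=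
      hX.sum_primitive_le hL1 ha0 hs.le fun i => (hη1 i).trans hη
    have hgap' : DLN.scaledLasso q b s (DLN.primitive (DLN.rescaledFlow (u ε) L) s) -
        DLN.scaledLasso q b s (z s) ≤
        DLN.gapBound d s ‖b‖ K m zd V (1 / L) (A / L) (Real.log (c * L) / L) := by
      refine hgap.trans ?_
      unfold DLN.gapBound DLN.energyBound
      rw [← hzd', ← hV]
      gcongr
    have e1 := DLN.lasso_eq_scaledLasso hl hs (fun i => hX.primitive_nonneg hs.le i)
      fun i => hflow.timeAverage_apply hL0 hs i
    have e2 := DLN.lasso_eq_scaledLasso hl hs (z := z s) (y := x s)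
      (fun i => mul_nonneg hs.le ((hx s hs).1 i)) fun i => by simp only [hzdef]; field_simp
    simp only [DLN.unscaledTime, hG]
    rw [e1, (hx s hs).posLassoMin_eq, e2]
    have := div_le_div_of_nonneg_right hgap' (sq_nonneg s)
    rw [sub_div] at this
    linarith
  have hfin : DLN.posLassoMin M r (1 / s) + s * (‖b‖ * √(2 * ((1 + K * s) * zd))) / s ^ 2 ≤
      DLN.posLassoMin M r (1 / s) + (‖b‖ * √(2 * (1 + K)) + 1) *
        (√(1 + s) / s * √zd + (1 + s) / s ^ 2 * zd) := by
    have h1 : √(2 * ((1 + K * s) * zd)) ≤ √(2 * (1 + K)) * √(1 + s) * √zd := by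
      rw [← Real.sqrt_mul (by positivity), ← Real.sqrt_mul (by positivity)]
      refine Real.sqrt_le_sqrt ?_
      have : 1 + K * s ≤ (1 + K) * (1 + s) := by nlinarith
      nlinarith [mul_le_mul_of_nonneg_right this hzd0]
    have h2 : s * (‖b‖ * √(2 * ((1 + K * s) * zd))) / s ^ 2 =
        ‖b‖ * √(2 * ((1 + K * s) * zd)) / s := by
      field_simp
    have h3 : ‖b‖ * √(2 * ((1 + K * s) * zd)) / s ≤
        ‖b‖ * √(2 * (1 + K)) * (√(1 + s) / s * √zd) := by
      calc _ ≤ ‖b‖ * (√(2 * (1 + K)) * √(1 + s) * √zd) / s := by gcongr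
        _ = _ := by ring
    have h4 : 0 ≤ √(1 + s) / s * √zd := by positivity
    have h5 : 0 ≤ (1 + s) / s ^ 2 * zd := by positivity
    have h6 : 0 ≤ ‖b‖ * √(2 * (1 + K)) := by positivity
    rw [h2]
    nlinarith [mul_nonneg h6 h5]
  have hlim : Tendsto (fun ε : ℝ => ((G (Real.log (1 / ε)) : ℝ) : EReal)) (𝓝[>] 0) _ :=
    (continuous_coe_real_ereal.tendsto _).comp (hGlim.comp hlog)
  refine (Filter.limsup_le_limsup (hle.mono fun ε h => EReal.coe_le_coe_iff.2 h)).trans ?_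
  rw [hlim.limsup_eq]
  exact EReal.coe_le_coe_iff.2 hfin
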